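/- **Setting.** Let $K\ge 2$, $s\ge 1$ and let $\mathcal Z$ be a measurable space whose singletons are measurable. A context is a family $x=(x_a)_{a\in[K]}\in\mathcal Z^K$. In round $t\in[n]$ the learner sees the context $x_t$, draws an action $A_t\in[K]$ from $\pi_t(\cdot\mid x_1,A_1,Y_1,\dots,x_{t-1},A_{t-1},Y_{t-1},x_t)$ and observes $Y_t=f(x_t,A_t)+\epsilon_t$, where, given the past and $A_t$, the noise $\epsilon_t$ is standard Gaussian. A policy is a sequence $\pi=(\pi_t)_t$ of such Markov kernels. For a parameter sequence $w=(w_i)_{i\ge1}$ and measurable features $\phi_i:\mathcal Z\to\mathbb R$, $i\ge1$, the reward function is $f_w(x,a)=\sum_{i\ge1}w_i\phi_i(x_a)$. The regret is $R_n(f)=\mathbb E\big[\sum_{t=1}^n\big(\max_{a\in[K]}f(x_t,a)-f(x_t,A_t)\big)\big]$. Write $\|w\|_0=|\{i:w_i\ne0\}|$, $\|w\|_1=\sum_i|w_i|$ and $\|\phi_i\|_\infty=\sup_{z\in\mathcal Z}|\phi_i(z)|$. **Theorem.** 1. (Polynomial decay.) Let $\beta>1$, let $m\ge s^{\beta+2}K^{\beta+1}$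 be an integer, let $n=sm$, and suppose that $\mathcal Z$ has at least $sK$ elements. Then for every policy there exist contexts $x_1,\dots,x_n$, a sequence $w$ with $\|w\|_0=s$ and $\|w\|_1=1$, and features $(\phi_i)_{i\ge1}$ with $\|\phi_i\|_\infty\le i^{-\beta/2}$ for all $i$, such that $$R_n(f_w)\ \ge\ \tfrac18\sqrt{Ksn}.$$ 2. (Exponential decay.) Let $\beta>0$, let $m\ge\lceil1/\beta\rceil\,s^2K\exp\!\big(s^\beta K^{\beta\lceil1/\beta\rceil}\big)$ be an integer, let $n=sm$, and suppose that $\mathcal Z$ has at least $s\lceil1/\beta\rceil K$ elements. Then for every policy there exist contexts $x_1,\dots,x_n$, a sequence $w$ with $\|w\|_0=s$ and $\|w\|_1=1$, and features $(\phi_i)_{i\ge1}$ with $\|\phi_i\|_\infty\le\exp(-i^\beta/2)$ for all $i$, such that $$R_n(f_w)\ \ge\ \tfrac18\sqrt{\max(1,1/\beta)\,Ksn}.$$ -/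

import Mathlib

open MeasureTheory ProbabilityTheory

noncomputable section

namespace SparseBandit

/-- A (randomised) policy of a contextual bandit algorithm with contexts in `X` and actions
`Fin K`. Rounds are numbered from `0`. In round `t` the policy is given the contexts of rounds
`0, …, t` and the action-reward pairs of rounds `0, …, t - 1`, and it returns the conditional
distribution of the action of round `t`. -/
structure Policy (X : Type*) [MeasurableSpace X] (K : ℕ) where
  /-- the conditional distribution of the action of round `t` -/
  kernel : ∀ t : ℕ, Kernel ((Fin (t + 1) → X) × (Fin t → Fin K × ℝ)) (Fin K)
  markov : ∀ t : ℕ, IsMarkovKernel (kernel t)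

variable {X : Type*} [MeasurableSpace X] {K : ℕ}

/-- The conditional law of the action-reward pair `(A_t, Y_t)` of round `t`, given the previous
action-reward pairs, when the contexts are `x` and the reward function is `f`: the action is drawn
from the policy, and `Y_t = f (x_t, A_t) + ε_t` with standard Gaussian noise `ε_t`. -/
def roundKernel (π : Policy X K) (f : X → Fin K → ℝ) (x : ℕ → X) (t : ℕ) :
    Kernel (Fin t → Fin K × ℝ) (Fin K × ℝ) :=
  ((π.kernel t).comap (fun h => ((fun i : Fin (t + 1) => x i), h)) measurable_prodMk_left) ⊗ₖ
    Kernel.prodMkLeft (Fin t → Fin K × ℝ)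
      (Kernel.ofFunOfCountable fun a : Fin K => gaussianReal (f (x t) a) 1)

/-- The law of the action-reward pairs `(A_0, Y_0), …, (A_{n-1}, Y_{n-1})` of the first `n` rounds,
when the contexts are `x`, the reward function is `f` and the policy is `π`. -/
def historyLaw (π : Policy X K) (f : X → Fin K → ℝ) (x : ℕ → X) :
    ∀ n : ℕ, Measure (Fin n → Fin K × ℝ)
  | 0 => Measure.dirac Fin.elim0
  | n + 1 => (historyLaw π f x n ⊗ₘ roundKernel π f x n).map
      fun p => (Fin.snoc p.1 p.2 : Fin (n + 1) → Fin K × ℝ)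

/-- The expected cumulative regret over `n` rounds of the policy `π`, when the contexts are `x` and
the reward function is `f`:
`R_n(f) = 𝔼 [∑_{t < n} (max_a f (x_t, a) - f (x_t, A_t))]`. -/
def regret (π : Policy X K) (f : X → Fin K → ℝ) (x : ℕ → X) (n : ℕ) : ℝ :=
  ∫ h, ∑ t : Fin n, ((⨆ a : Fin K, f (x t) a) - f (x t) (h t).1) ∂(historyLaw π f x n)

/-- The reward function `f_w (x, a) = ∑_i w_i φ_i (x_a)` with parameter sequence `w` and features
`φ`; a context is a family `x = (x_a)` of elements of `Z`, one for each action. -/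
def rewardFun {Z : Type*} (w : ℕ → ℝ) (φ : ℕ → Z → ℝ) (x : Fin K → Z) (a : Fin K) : ℝ :=
  ∑' i, w i * φ i (x a)

/-- `‖w‖₀ = s` and `‖w‖₁ = 1`. -/
def IsSparseUnit (s : ℕ) (w : ℕ → ℝ) : Prop :=
  {i | w i ≠ 0}.encard = s ∧ HasSum (fun i => |w i|) 1

/-- Polynomial decay: `‖φ_i‖_∞ ≤ i ^ (-β/2)` for `i = 1, 2, …`. The entry `φ i` of a sequence
indexed by `ℕ` is the feature with number `i + 1`. -/
def PolyDecay {Z : Type*} (β : ℝ) (φ : ℕ → Z → ℝ) : Prop :=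
  ∀ i z, |φ i z| ≤ ((i : ℝ) + 1) ^ (-β / 2)

/-- Exponential decay: `‖φ_i‖_∞ ≤ exp (-i ^ β / 2)` for `i = 1, 2, …`. The entry `φ i` of a
sequence indexed by `ℕ` is the feature with number `i + 1`. -/
def ExpDecay {Z : Type*} (β : ℝ) (φ : ℕ → Z → ℝ) : Prop :=
  ∀ i z, |φ i z| ≤ Real.exp (-((i : ℝ) + 1) ^ β / 2)

end SparseBandit

end

/-!
The horizon consists of `s` blocks of `m` rounds. A block has `d` contexts of its own, which are
shown cyclically, so that the problem splits into `s * d` independent `K`-armed bandits ("cells"),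
each visited about `m / d` times. In every cell one action has mean reward
`Δ = √(d * K / m) / 2` and the others have mean `0`. The best actions of the `d` cells of a block
are an element of `Fin d → Fin K`, and one feature is reserved for each block and each such
element: `s * K ^ d` features, of which a parameter with `s` weights `1 / s` selects one per block
(`rewardFun_cellWeight_cellFeature`). The features have height `s * Δ`, and the lower bound on `m`
says that this is below the prescribed bound for all numbers up to `s * K ^ d`. Polynomial decay
uses `d = 1`. Exponential decay uses `d = ⌈1 / β⌉`.

For the lower bound, the best actions `u` are drawn uniformly. In round `t` with cell `c`, resample
`u c` as `a` and compare with the environment in which all rewards of `c` vanish. The probability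
of playing `a` grows by at most `KL + 1 / 8` (`actionProb_le`), where `KL` is `Δ ^ 2 / 2` times the
expected number of earlier plays of `a` in `c`. Summed over `a`, the expected numbers of plays give
the number of visits to `c`, which is at most `m / d` (`card_filter_same_cell_mul_le`); hence the
best action is played with probability at most `1 / K + 1 / 8 + 1 / 8 ≤ 3 / 4` on average
(`sum_actionProb_update_le`). Some `u` has regret at least `s * m * Δ / 4`, which equals
`√(d * K * s * (s * m)) / 8`.

The comparison of action probabilities rests on the Donsker-Varadhan inequality
`exp (∫ F dQ - KL) ≤ ∫ exp F dP` for bounded `F`, proved by induction over the rounds from the case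
of two Gaussian laws (`exp_integral_historyLaw_sub_le`), and on Hoeffding's lemma.
-/

open MeasureTheory ProbabilityTheory

noncomputable section

namespace SparseBandit

variable {X : Type*} [MeasurableSpace X] {K : ℕ}

/-! ### Change of measure for bounded test functions -/

lemma integrable_of_forall_abs_le {α : Type*} [MeasurableSpace α] {μ : Measure α}
    [IsFiniteMeasure μ] {F : α → ℝ} (hF : Measurable F) {B : ℝ} (hB : ∀ a, |F a| ≤ B) :
    Integrable F μ :=
  Integrable.of_bound hF.aestronglyMeasurable B (ae_of_all _ hB)

lemma abs_integral_le_of_forall_abs_le {α : Type*} [MeasurableSpace α] {μ : Measure α}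
    [IsProbabilityMeasure μ] {F : α → ℝ} {B : ℝ} (hB : ∀ a, |F a| ≤ B) : |∫ a, F a ∂μ| ≤ B := by
  simpa using norm_integral_le_of_norm_le_const (μ := μ) (f := F) (C := B) (ae_of_all _ hB)

lemma integrable_exp_of_forall_abs_le {α : Type*} [MeasurableSpace α] {μ : Measure α}
    [IsFiniteMeasure μ] {F : α → ℝ} (hF : Measurable F) {B : ℝ} (hB : ∀ a, |F a| ≤ B) :
    Integrable (fun a => Real.exp (F a)) μ :=
  integrable_of_forall_abs_le (B := Real.exp B) (by fun_prop) fun a => by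
    rw [Real.abs_exp]
    exact Real.exp_le_exp.2 (abs_le.1 (hB a)).2

/-- Jensen's inequality for the exponential function. -/
lemma exp_integral_le_integral_exp {α : Type*} [MeasurableSpace α] {μ : Measure α}
    [IsProbabilityMeasure μ] {F : α → ℝ} (hF : Integrable F μ)
    (hexp : Integrable (fun a => Real.exp (F a)) μ) :
    Real.exp (∫ a, F a ∂μ) ≤ ∫ a, Real.exp (F a) ∂μ :=
  convexOn_exp.map_integral_le Real.continuous_exp.continuousOn isClosed_univ (by simp) hF hexp

lemma gaussianPDFReal_mul_exp (μ ν y u : ℝ) :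
    gaussianPDFReal μ 1 y * Real.exp u =
      gaussianPDFReal ν 1 y * Real.exp (u + (μ - ν) * (y - ν) - (μ - ν) ^ 2 / 2) := by
  simp only [gaussianPDFReal, mul_assoc, ← Real.exp_add]
  congr 2
  simp only [NNReal.coe_one]
  ring

/-- The Donsker-Varadhan inequality for two Gaussian laws with unit variance, whose
Kullback-Leibler divergence is `(μ - ν) ^ 2 / 2`. -/
lemma exp_integral_gaussianReal_sub_le (μ ν : ℝ) {F : ℝ → ℝ} (hF : Measurable F) {B : ℝ}
    (hB : ∀ y, |F y| ≤ B) :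
    Real.exp (∫ y, F y ∂gaussianReal ν 1 - (μ - ν) ^ 2 / 2) ≤
      ∫ y, Real.exp (F y) ∂gaussianReal μ 1 := by
  have hshift : (fun y => gaussianPDFReal μ 1 y * Real.exp (F y)) = fun y =>
      gaussianPDFReal ν 1 y * Real.exp (F y + (μ - ν) * (y - ν) - (μ - ν) ^ 2 / 2) :=
    funext fun y => gaussianPDFReal_mul_exp μ ν y (F y)
  have hid : Integrable (fun y : ℝ => y) (gaussianReal ν 1) :=
    (memLp_id_gaussianReal (μ := ν) (v := 1) 1).integrable (by simp)
  have hF' := integrable_of_forall_abs_le (μ := gaussianReal ν 1) hF hB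
  have hlin : Integrable (fun y => (μ - ν) * (y - ν)) (gaussianReal ν 1) :=
    (hid.sub (integrable_const ν)).const_mul _
  have hadd : Integrable (fun y => F y + (μ - ν) * (y - ν)) (gaussianReal ν 1) := hF'.add hlin
  have hint : Integrable (fun y => F y + (μ - ν) * (y - ν) - (μ - ν) ^ 2 / 2)
      (gaussianReal ν 1) := hadd.sub (integrable_const _)
  have hexp : Integrable (fun y => Real.exp (F y + (μ - ν) * (y - ν) - (μ - ν) ^ 2 / 2))
      (gaussianReal ν 1) := by
    have h := integrable_exp_of_forall_abs_le (μ := gaussianReal μ 1) hF hB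
    rw [gaussianReal_of_var_ne_zero _ one_ne_zero] at h ⊢
    rw [integrable_withDensity_iff_integrable_smul' (by fun_prop)
      (ae_of_all _ fun _ => gaussianPDF_lt_top)] at h ⊢
    simpa only [toReal_gaussianPDF, smul_eq_mul, ← gaussianPDFReal_mul_exp] using h
  have hval : ∫ y, (F y + (μ - ν) * (y - ν) - (μ - ν) ^ 2 / 2) ∂gaussianReal ν 1 =
      ∫ y, F y ∂gaussianReal ν 1 - (μ - ν) ^ 2 / 2 := by
    rw [integral_sub hadd (integrable_const _), integral_add hF' hlin,
      integral_const_mul, integral_sub hid (integrable_const ν), integral_id_gaussianReal]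
    simp
  rw [← hval, integral_gaussianReal_eq_integral_smul one_ne_zero (f := fun y => Real.exp (F y))]
  simp only [smul_eq_mul]
  rw [hshift]
  simpa only [integral_gaussianReal_eq_integral_smul one_ne_zero, smul_eq_mul] using
    exp_integral_le_integral_exp hint hexp

/-! ### Laws of the interaction -/

instance (π : Policy X K) (t : ℕ) : IsMarkovKernel (π.kernel t) := π.markov t

instance (π : Policy X K) (f : X → Fin K → ℝ) (x : ℕ → X) (t : ℕ) :
    IsMarkovKernel (roundKernel π f x t) := by
  have : IsMarkovKernel
      (Kernel.ofFunOfCountable fun a : Fin K => gaussianReal (f (x t) a) 1) :=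
    ⟨fun a => inferInstanceAs (IsProbabilityMeasure (gaussianReal (f (x t) a) 1))⟩
  unfold roundKernel
  infer_instance

lemma measurable_snoc {α : Type*} [MeasurableSpace α] (n : ℕ) :
    Measurable fun p : (Fin n → α) × α => (Fin.snoc p.1 p.2 : Fin (n + 1) → α) := by
  refine measurable_pi_iff.2 fun i => ?_
  induction i using Fin.lastCases with
  | last => simpa using measurable_snd
  | cast i =>
    simp only [Fin.snoc_castSucc]
    exact (measurable_pi_apply i).comp measurable_fst

instance (π : Policy X K) (f : X → Fin K → ℝ) (x : ℕ → X) (n : ℕ) :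
    IsProbabilityMeasure (historyLaw π f x n) := by
  induction n with
  | zero => exact inferInstanceAs (IsProbabilityMeasure (Measure.dirac _))
  | succ n ih => exact Measure.isProbabilityMeasure_map (measurable_snoc n).aemeasurable

/-- The conditional probability that the action of round `t` is `a`, given the history `h`. -/
def choiceProb (π : Policy X K) (x : ℕ → X) (t : ℕ) (h : Fin t → Fin K × ℝ) (a : Fin K) : ℝ :=
  (π.kernel t ((fun i : Fin (t + 1) => x i), h)).real {a}

/-- The probability that the action of round `t` is `a`. -/
def actionProb (π : Policy X K) (f : X → Fin K → ℝ) (x : ℕ → X) (t : ℕ) (a : Fin K) : ℝ :=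
  ∫ h, choiceProb π x t h a ∂historyLaw π f x t

section

variable (π : Policy X K) (f g : X → Fin K → ℝ) (x : ℕ → X)

lemma choiceProb_nonneg (t : ℕ) (h : Fin t → Fin K × ℝ) (a : Fin K) :
    0 ≤ choiceProb π x t h a := measureReal_nonneg

lemma choiceProb_le_one (t : ℕ) (h : Fin t → Fin K × ℝ) (a : Fin K) :
    choiceProb π x t h a ≤ 1 := measureReal_le_one

lemma abs_choiceProb_le_one (t : ℕ) (a : Fin K) (h : Fin t → Fin K × ℝ) :
    |choiceProb π x t h a| ≤ 1 := by
  rw [abs_of_nonneg (choiceProb_nonneg π x t h a)]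
  exact choiceProb_le_one π x t h a

lemma sum_choiceProb (t : ℕ) (h : Fin t → Fin K × ℝ) : ∑ a, choiceProb π x t h a = 1 := by
  simp [choiceProb]

lemma measurable_choiceProb (t : ℕ) (a : Fin K) :
    Measurable fun h => choiceProb π x t h a :=
  (((π.kernel t).measurable_coe (measurableSet_singleton a)).comp
    measurable_prodMk_left).ennreal_toReal

lemma integrable_choiceProb (t : ℕ) (a : Fin K) :
    Integrable (fun h => choiceProb π x t h a) (historyLaw π f x t) :=
  integrable_of_forall_abs_le (measurable_choiceProb π x t a) (abs_choiceProb_le_one π x t a)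

lemma sum_actionProb (t : ℕ) : ∑ a, actionProb π f x t a = 1 := by
  simp only [actionProb]
  rw [← integral_finsetSum _ fun a _ => integrable_choiceProb π f x t a]
  simp [sum_choiceProb]

lemma integral_roundKernel (t : ℕ) (h : Fin t → Fin K × ℝ) {G : Fin K × ℝ → ℝ}
    (hG : Measurable G) {B : ℝ} (hB : ∀ p, |G p| ≤ B) :
    ∫ p, G p ∂roundKernel π f x t h =
      ∑ a, choiceProb π x t h a * ∫ y, G (a, y) ∂gaussianReal (f (x t) a) 1 := by
  have : IsMarkovKernel
      (Kernel.ofFunOfCountable fun a : Fin K => gaussianReal (f (x t) a) 1) :=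
    ⟨fun a => inferInstanceAs (IsProbabilityMeasure (gaussianReal (f (x t) a) 1))⟩
  have hint := integrable_of_forall_abs_le (μ := roundKernel π f x t h) hG hB
  unfold roundKernel at hint ⊢
  rw [ProbabilityTheory.integral_compProd hint, integral_fintype (Integrable.of_finite)]
  rfl

lemma integral_historyLaw_succ (n : ℕ) {F : (Fin (n + 1) → Fin K × ℝ) → ℝ} (hF : Measurable F)
    {B : ℝ} (hB : ∀ h, |F h| ≤ B) :
    ∫ h, F h ∂historyLaw π f x (n + 1) =
      ∫ h, ∫ p, F (Fin.snoc h p) ∂roundKernel π f x n h ∂historyLaw π f x n := by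
  have hm : Measurable fun p : (Fin n → Fin K × ℝ) × (Fin K × ℝ) =>
      F (Fin.snoc p.1 p.2 : Fin (n + 1) → Fin K × ℝ) := hF.comp (measurable_snoc n)
  rw [historyLaw, integral_map (measurable_snoc n).aemeasurable hF.aestronglyMeasurable,
    Measure.integral_compProd (integrable_of_forall_abs_le hm fun p => hB _)]

/-- The expectation of a sum of functions of the actions depends on the law of the interaction
through the probabilities `actionProb` only. -/
lemma integral_sum_action (n : ℕ) (G : ℕ → Fin K → ℝ) :
    ∫ h, ∑ t : Fin n, G t (h t).1 ∂historyLaw π f x n =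
      ∑ t ∈ Finset.range n, ∑ a, actionProb π f x t a * G t a := by
  have hmG (t : ℕ) : Measurable (G t) := measurable_of_finite _
  have hms (n : ℕ) : Measurable fun h : Fin n → Fin K × ℝ => ∑ t : Fin n, G t (h t).1 :=
    Finset.measurable_sum _ fun t _ => (hmG t).comp (by fun_prop)
  have hbs (n : ℕ) (h : Fin n → Fin K × ℝ) :
      |∑ t : Fin n, G t (h t).1| ≤ ∑ t : Fin n, ∑ a, |G t a| :=
    (Finset.abs_sum_le_sum_abs _ _).trans <| Finset.sum_le_sum fun t _ =>
      Finset.single_le_sum (f := fun a => |G t a|) (fun _ _ => abs_nonneg _)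
        (Finset.mem_univ (h t).1)
  induction n with
  | zero => simp
  | succ n ih =>
    rw [integral_historyLaw_succ π f x n (hms _) (hbs _), Finset.sum_range_succ, ← ih]
    have hstep (h : Fin n → Fin K × ℝ) :
        ∫ p, ∑ t : Fin (n + 1), G t ((Fin.snoc h p : Fin (n + 1) → Fin K × ℝ) t).1
            ∂roundKernel π f x n h =
          ∑ t : Fin n, G t (h t).1 + ∑ a, choiceProb π x n h a * G n a := by
      have hm : Measurable fun p : Fin K × ℝ =>
          ∑ t : Fin (n + 1), G t ((Fin.snoc h p : Fin (n + 1) → Fin K × ℝ) t).1 :=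
        (hms (n + 1)).comp ((measurable_snoc n).comp measurable_prodMk_left)
      rw [integral_roundKernel π f x n h hm (fun p => hbs _ _)]
      simp [Fin.sum_univ_castSucc, mul_add, Finset.sum_add_distrib, ← Finset.sum_mul,
        sum_choiceProb]
    simp only [hstep]
    have hc (a : Fin K) := (integrable_choiceProb π f x n a).mul_const (G n a)
    rw [integral_add (integrable_of_forall_abs_le (hms n) (hbs n))
        (integrable_finsetSum _ fun a _ => hc a), integral_finsetSum _ fun a _ => hc a]
    simp only [integral_mul_const, actionProb]

lemma regret_eq_sum (n : ℕ) :
    regret π f x n = ∑ t ∈ Finset.range n, ∑ a, actionProb π f x t a *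
      ((⨆ b, f (x t) b) - f (x t) a) :=
  integral_sum_action π f x n fun t a => (⨆ b, f (x t) b) - f (x t) a

/-- The Donsker-Varadhan inequality for the laws of one round with the reward functions `f` and
`g`, given the history. -/
lemma exp_integral_roundKernel_sub_le (t : ℕ) (h : Fin t → Fin K × ℝ) {G : Fin K × ℝ → ℝ}
    (hG : Measurable G) {B : ℝ} (hB : ∀ p, |G p| ≤ B) :
    Real.exp (∫ p, G p ∂roundKernel π g x t h -
        ∑ a, choiceProb π x t h a * ((f (x t) a - g (x t) a) ^ 2 / 2)) ≤
      ∫ p, Real.exp (G p) ∂roundKernel π f x t h := by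
  rw [integral_roundKernel π g x t h hG hB, ← Finset.sum_sub_distrib,
    integral_roundKernel π f x t h (G := fun p => Real.exp (G p)) (B := Real.exp B) (by fun_prop)
      fun p => by
        rw [Real.abs_exp]
        exact Real.exp_le_exp.2 (abs_le.1 (hB p)).2]
  simp only [← mul_sub]
  refine (convexOn_exp.map_sum_le (t := Finset.univ) (fun a _ => choiceProb_nonneg π x t h a)
    (sum_choiceProb π x t h) (by simp)).trans (Finset.sum_le_sum fun a _ => ?_)
  exact mul_le_mul_of_nonneg_left (exp_integral_gaussianReal_sub_le _ _ (by fun_prop)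
    fun y => hB _) (choiceProb_nonneg π x t h a)

/-- The Donsker-Varadhan inequality for the laws of the history with the reward functions `f` and
`g`. The subtracted sum is the Kullback-Leibler divergence of the law with `g` from the law
with `f`, as given by the chain rule. -/
lemma exp_integral_historyLaw_sub_le (n : ℕ) {F : (Fin n → Fin K × ℝ) → ℝ} (hF : Measurable F)
    {B : ℝ} (hB : ∀ h, |F h| ≤ B) :
    Real.exp (∫ h, F h ∂historyLaw π g x n - ∑ t ∈ Finset.range n, ∑ a,
        actionProb π g x t a * ((f (x t) a - g (x t) a) ^ 2 / 2)) ≤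
      ∫ h, Real.exp (F h) ∂historyLaw π f x n := by
  induction n generalizing B with
  | zero => simp [historyLaw]
  | succ n ih =>
    set D : Fin K → ℝ := fun a => (f (x n) a - g (x n) a) ^ 2 / 2
    set cost : (Fin n → Fin K × ℝ) → ℝ := fun h => ∑ a, choiceProb π x n h a * D a
    set R : (Fin n → Fin K × ℝ) → ℝ := fun h => ∫ p, F (Fin.snoc h p) ∂roundKernel π g x n h
    have hm (h : Fin n → Fin K × ℝ) : Measurable fun p => F (Fin.snoc h p) :=
      hF.comp ((measurable_snoc n).comp measurable_prodMk_left)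
    have hcost : Measurable cost :=
      Finset.measurable_sum _ fun a _ => (measurable_choiceProb π x n a).mul_const _
    have hcostB (h) : |cost h| ≤ ∑ a, |D a| :=
      (Finset.abs_sum_le_sum_abs _ _).trans <| Finset.sum_le_sum fun a _ => by
        rw [abs_mul]
        exact mul_le_of_le_one_left (abs_nonneg _) (abs_choiceProb_le_one π x n a h)
    have hR : Measurable R :=
      ((hF.comp (measurable_snoc n)).stronglyMeasurable.integral_kernel_prod_right'
        (κ := roundKernel π g x n)).measurable
    have hRB (h) : |R h| ≤ B := abs_integral_le_of_forall_abs_le fun p => hB _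
    have hF'B (h) : |R h - cost h| ≤ B + ∑ a, |D a| :=
      (abs_sub _ _).trans (add_le_add (hRB h) (hcostB h))
    have hexpB (h) : |Real.exp (F h)| ≤ Real.exp B := by
      rw [Real.abs_exp]
      exact Real.exp_le_exp.2 (abs_le.1 (hB h)).2
    have hc (a : Fin K) := (integrable_choiceProb π g x n a).mul_const (D a)
    have hcostInt : ∫ h, cost h ∂historyLaw π g x n = ∑ a, actionProb π g x n a * D a := by
      rw [integral_finsetSum _ fun a _ => hc a]
      simp only [integral_mul_const, actionProb]
    rw [integral_historyLaw_succ π g x n hF hB,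
      integral_historyLaw_succ π f x n (by fun_prop) hexpB, Finset.sum_range_succ]
    have key := ih (F := fun h => R h - cost h) (hR.sub hcost) hF'B
    rw [integral_sub (integrable_of_forall_abs_le hR hRB)
      (integrable_of_forall_abs_le hcost hcostB), hcostInt] at key
    rw [show ∀ a b c : ℝ, a - (b + c) = a - c - b by intros; ring]
    refine key.trans (integral_mono ?_ ?_ fun h => ?_)
    · exact integrable_exp_of_forall_abs_le (hR.sub hcost) hF'B
    · refine integrable_of_forall_abs_le (B := Real.exp B) ?_ fun h =>
        abs_integral_le_of_forall_abs_le fun p => hexpB _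
      exact ((Real.measurable_exp.comp
        (hF.comp (measurable_snoc n))).stronglyMeasurable.integral_kernel_prod_right'
          (κ := roundKernel π f x n)).measurable
    · exact exp_integral_roundKernel_sub_le π f g x n h (hm h) fun p => hB _

/-- A linear form of Pinsker's inequality for the probability of an action: the difference is at
most `KL + 1 / 8`, an upper bound of `√(KL / 2)`. It is the Donsker-Varadhan inequality for the test
function `-choiceProb`. -/
lemma actionProb_le (n : ℕ) (a : Fin K) :
    actionProb π f x n a ≤ actionProb π g x n a + ∑ t ∈ Finset.range n, ∑ b,
      actionProb π g x t b * ((f (x t) b - g (x t) b) ^ 2 / 2) + 1 / 8 := by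
  have hm := measurable_choiceProb π x n a
  have hdv := exp_integral_historyLaw_sub_le π f g x n (F := fun h => -choiceProb π x n h a)
    hm.neg (B := 1) fun h => by
      rw [abs_neg]
      exact abs_choiceProb_le_one π x n a h
  -- Hoeffding's lemma bounds the moment generating function of a variable with values in `[0, 1]`.
  have hh := (hasSubgaussianMGF_of_mem_Icc (μ := historyLaw π f x n) hm.aemeasurable (a := 0)
    (b := 1) (ae_of_all _ fun h =>
      ⟨choiceProb_nonneg π x n h a, choiceProb_le_one π x n h a⟩)).mgf_le (-1)
  change mgf (fun h => choiceProb π x n h a - actionProb π f x n a) _ _ ≤ _ at hh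
  have hmgf : ∫ h, Real.exp (-choiceProb π x n h a) ∂historyLaw π f x n =
      Real.exp (-actionProb π f x n a) *
        mgf (fun h => choiceProb π x n h a - actionProb π f x n a) (historyLaw π f x n) (-1) := by
    rw [mgf, ← integral_const_mul]
    refine integral_congr_ae (ae_of_all _ fun h => ?_)
    simp only [← Real.exp_add]
    congr 1
    ring
  rw [hmgf, integral_neg] at hdv
  have h1 := hdv.trans (mul_le_mul_of_nonneg_left hh (Real.exp_pos _).le)
  rw [← Real.exp_add, Real.exp_le_exp] at h1
  change -actionProb π g x n a - _ ≤ _ at h1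
  norm_num at h1
  linarith

end

/-! ### Averaging over the best actions of independent cells -/

/-- A uniform random assignment stays uniform when its value at `c` is resampled. -/
lemma card_mul_sum_eq_sum_update {C A : Type*} [Fintype C] [DecidableEq C] [Fintype A]
    (G : (C → A) → ℝ) (c : C) :
    Fintype.card A * ∑ u, G u = ∑ u, ∑ a, G (Function.update u c a) := by
  let e : (C → A) × A ≃ (C → A) × A :=
    { toFun := fun p => (Function.update p.1 c p.2, p.1 c)
      invFun := fun p => (Function.update p.1 c p.2, p.1 c)
      left_inv := fun p => by simp
      right_inv := fun p => by simp }
  rw [← Fintype.sum_prod_type' fun u a => G (Function.update u c a)]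
  rw [show ∑ p : (C → A) × A, G (Function.update p.1 c p.2) = ∑ p : (C → A) × A, G (e p).1 from
    rfl, e.sum_comp fun p => G p.1, Fintype.sum_prod_type, Finset.mul_sum]
  simp

section

variable {C : Type*} {ctx : C → X}
  {F : (C → Fin K) → X → Fin K → ℝ} {Δ : ℝ}

/-- If the best action of a cell is uniformly distributed, and the gap is too small for it to be
detected in the visits to the cell so far, then the policy plays it with probability at most
`3 / 4`. -/
lemma sum_actionProb_update_le [DecidableEq C] (π : Policy X K) (hK : 2 ≤ K)
    (hctx : Function.Injective ctx)
    (hF : ∀ u c a, F u (ctx c) a = if a = u c then Δ else 0) (cell : ℕ → C) (t : ℕ)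
    (ht : ((Finset.range t).filter fun i => cell i = cell t).card * Δ ^ 2 ≤ K / 4)
    (u : C → Fin K) :
    ∑ a, actionProb π (F (Function.update u (cell t) a)) (fun i => ctx (cell i)) t a ≤
      K * (3 / 4) := by
  classical
  set c := cell t
  set x : ℕ → X := fun i => ctx (cell i)
  -- The reference environment differs from the compared ones in the cell of round `t` only,
  -- where all its rewards vanish.
  let g : X → Fin K → ℝ := fun y b => if y = ctx c then 0 else F u y b
  have hdiff (a : Fin K) (i : ℕ) (b : Fin K) :
      F (Function.update u c a) (x i) b - g (x i) b =
        if cell i = c then (if b = a then Δ else 0) else 0 := by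
    by_cases hi : cell i = c
    · simp [g, x, hF, hi]
    · simp [g, x, hF, hi, hctx.eq_iff]
  have hkl (a : Fin K) : ∑ i ∈ Finset.range t, ∑ b, actionProb π g x i b *
      ((F (Function.update u c a) (x i) b - g (x i) b) ^ 2 / 2) =
        ∑ i ∈ Finset.range t, if cell i = c then actionProb π g x i a * (Δ ^ 2 / 2) else 0 := by
    refine Finset.sum_congr rfl fun i _ => ?_
    simp only [hdiff]
    split_ifs with hi
    · rw [Finset.sum_eq_single a (fun b _ hb => by simp [hb]) (by simp)]
      simp
    · simp
  have hsum : ∑ a, ∑ i ∈ Finset.range t,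
      (if cell i = c then actionProb π g x i a * (Δ ^ 2 / 2) else 0) =
        ((Finset.range t).filter fun i => cell i = c).card * (Δ ^ 2 / 2) := by
    rw [Finset.sum_comm]
    have hcell (i : ℕ) : ∑ a, (if cell i = c then actionProb π g x i a * (Δ ^ 2 / 2) else 0) =
        if cell i = c then Δ ^ 2 / 2 else 0 := by
      split_ifs
      · rw [← Finset.sum_mul, sum_actionProb, one_mul]
      · simp
    simp only [hcell, ← Finset.sum_filter, Finset.sum_const, nsmul_eq_mul]
  calc ∑ a, actionProb π (F (Function.update u c a)) x t a
      ≤ ∑ a, (actionProb π g x t a + ∑ i ∈ Finset.range t,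
          (if cell i = c then actionProb π g x i a * (Δ ^ 2 / 2) else 0) + 1 / 8) :=
        Finset.sum_le_sum fun a _ => by
          have h := actionProb_le π (F (Function.update u c a)) g x t a
          rwa [hkl] at h
    _ = 1 + ((Finset.range t).filter fun i => cell i = c).card * (Δ ^ 2 / 2) + K * (1 / 8) := by
        rw [Finset.sum_add_distrib, Finset.sum_add_distrib, sum_actionProb, hsum]
        simp
    _ ≤ K * (3 / 4) := by
        have : (2 : ℝ) ≤ K := by exact_mod_cast hK
        linarith

lemma regret_eq_sum_gap (π : Policy X K) (hK : 2 ≤ K) (hΔ : 0 ≤ Δ)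
    (hF : ∀ u c a, F u (ctx c) a = if a = u c then Δ else 0) (cell : ℕ → C) (n : ℕ)
    (u : C → Fin K) :
    regret π (F u) (fun i => ctx (cell i)) n = ∑ t ∈ Finset.range n,
      Δ * (1 - actionProb π (F u) (fun i => ctx (cell i)) t (u (cell t))) := by
  have : Nonempty (Fin K) := ⟨⟨0, by omega⟩⟩
  rw [regret_eq_sum]
  refine Finset.sum_congr rfl fun t _ => ?_
  have hsup : ⨆ b, F u (ctx (cell t)) b = Δ := by
    simp only [hF]
    refine ciSup_eq_of_forall_le_of_forall_lt_exists_gt (fun b => ?_)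
      fun w hw => ⟨u (cell t), by simpa using hw⟩
    split_ifs <;> simp [hΔ]
  rw [hsup]
  simp only [hF, mul_sub, Finset.sum_sub_distrib, ← Finset.sum_mul, sum_actionProb]
  simp [mul_comm]

/-- Some assignment of best actions to the cells forces a regret of a quarter of the gap per
round. -/
lemma exists_le_regret [Fintype C] [DecidableEq C] (π : Policy X K) (hK : 2 ≤ K)
    (hctx : Function.Injective ctx) (hΔ : 0 ≤ Δ)
    (hF : ∀ u c a, F u (ctx c) a = if a = u c then Δ else 0) (cell : ℕ → C) (n : ℕ)
    (hn : ∀ t < n, ((Finset.range t).filter fun i => cell i = cell t).card * Δ ^ 2 ≤ K / 4) :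
    ∃ u, n * (Δ / 4) ≤ regret π (F u) (fun i => ctx (cell i)) n := by
  have : Nonempty (Fin K) := ⟨⟨0, by omega⟩⟩
  have hK0 : (0 : ℝ) < K := by positivity
  suffices h : ∑ _u : C → Fin K, n * (Δ / 4) ≤
      ∑ u, regret π (F u) (fun i => ctx (cell i)) n by
    obtain ⟨u, _, hu⟩ := Finset.exists_le_of_sum_le Finset.univ_nonempty h
    exact ⟨u, hu⟩
  simp only [regret_eq_sum_gap π hK hΔ hF]
  rw [Finset.sum_comm]
  have hround (t : ℕ) (ht : t < n) : ∑ u, actionProb π (F u) (fun i => ctx (cell i)) t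
      (u (cell t)) ≤ Fintype.card (C → Fin K) * (3 / 4) := by
    refine le_of_mul_le_mul_left ?_ hK0
    have h := card_mul_sum_eq_sum_update
      (fun u => actionProb π (F u) (fun i => ctx (cell i)) t (u (cell t))) (cell t)
    simp only [Function.update_self, Fintype.card_fin] at h
    rw [h]
    refine (Finset.sum_le_sum fun u _ =>
      sum_actionProb_update_le π hK hctx hF cell t (hn t ht) u).trans_eq ?_
    rw [Finset.sum_const, Finset.card_univ, nsmul_eq_mul]
    ring
  calc ∑ _u : C → Fin K, n * (Δ / 4)
      = ∑ t ∈ Finset.range n, Δ * (Fintype.card (C → Fin K) * (1 / 4)) := by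
        simp only [Finset.sum_const, Finset.card_univ, nsmul_eq_mul, Finset.card_range]
        ring
    _ ≤ _ := Finset.sum_le_sum fun t ht => by
        rw [← Finset.mul_sum, Finset.sum_sub_distrib]
        refine mul_le_mul_of_nonneg_left ?_ hΔ
        have := hround t (Finset.mem_range.1 ht)
        simp only [Finset.sum_const, Finset.card_univ, nsmul_eq_mul, mul_one]
        linarith

end

/-! ### Encoding of the best actions by a sparse parameter -/

section

variable {Z : Type*} {s d : ℕ}

/-- The features of the construction. The feature of number `idx (j, v)` is `H` at the point that
action `v l` has in the context of the cell `(j, l)`, for each `l`, and vanishes elsewhere; features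
with a number outside the range of `idx` vanish. -/
def cellFeature (pt : (Fin s × Fin d) × Fin K → Z) (idx : Fin s × (Fin d → Fin K) → ℕ) (H : ℝ) :
    ℕ → Z → ℝ :=
  Function.extend idx
    (fun q => (Set.range fun l => pt ((q.1, l), q.2 l)).indicator fun _ => H) 0

/-- The parameter that selects, with equal weights, the feature of the best actions
`u (j, 0), …, u (j, d - 1)` for each block `j`. -/
def cellWeight (idx : Fin s × (Fin d → Fin K) → ℕ) (u : Fin s × Fin d → Fin K) : ℕ → ℝ :=
  Function.extend (fun j => idx (j, fun l => u (j, l))) (fun _ => (s : ℝ)⁻¹) 0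

variable {pt : (Fin s × Fin d) × Fin K → Z} {idx : Fin s × (Fin d → Fin K) → ℕ} {H : ℝ}

lemma abs_cellFeature_le (hidx : Function.Injective idx) (hH : 0 ≤ H) {b : ℕ → ℝ}
    (hb : ∀ i, 0 ≤ b i) (hHb : ∀ q, H ≤ b (idx q)) (i : ℕ) (z : Z) :
    |cellFeature pt idx H i z| ≤ b i := by
  by_cases h : ∃ q, idx q = i
  · obtain ⟨q, rfl⟩ := h
    rw [cellFeature, hidx.extend_apply, abs_of_nonneg (Set.indicator_nonneg (fun _ _ => hH) z)]
    exact Set.indicator_le' (fun _ _ => hHb q) (fun _ _ => hb _) z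
  · rw [cellFeature, Function.extend_apply' _ _ _ h]
    simpa using hb i

lemma measurable_cellFeature [MeasurableSpace Z] [MeasurableSingletonClass Z]
    (hidx : Function.Injective idx) (i : ℕ) : Measurable (cellFeature pt idx H i) := by
  by_cases h : ∃ q, idx q = i
  · obtain ⟨q, rfl⟩ := h
    rw [cellFeature, hidx.extend_apply]
    exact measurable_const.indicator (Set.finite_range _).measurableSet
  · rw [cellFeature, Function.extend_apply' _ _ _ h]
    exact measurable_zero

lemma injective_selectedIdx (hidx : Function.Injective idx) (u : Fin s × Fin d → Fin K) :
    Function.Injective fun j => idx (j, fun l => u (j, l)) :=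
  fun _ _ h => congrArg Prod.fst (hidx h)

lemma hasSum_cellWeight_mul (hidx : Function.Injective idx) (u : Fin s × Fin d → Fin K)
    (G : ℕ → ℝ) : HasSum (fun i => cellWeight idx u i * G i)
      (∑ j, (s : ℝ)⁻¹ * G (idx (j, fun l => u (j, l)))) := by
  have hinj := injective_selectedIdx hidx u
  rw [← hinj.hasSum_iff fun i hi => by
    rw [cellWeight, Function.extend_apply' _ _ _ hi]
    simp]
  convert hasSum_fintype _ using 2 with j
  simp only [Function.comp_apply, cellWeight]
  rw [hinj.extend_apply]

lemma isSparseUnit_cellWeight (hs : 1 ≤ s) (hidx : Function.Injective idx)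
    (u : Fin s × Fin d → Fin K) : IsSparseUnit s (cellWeight idx u) := by
  have hinj := injective_selectedIdx hidx u
  have hs0 : (s : ℝ) ≠ 0 := by positivity
  have hnn (i : ℕ) : 0 ≤ cellWeight idx u i := by
    by_cases h : ∃ j, idx (j, fun l => u (j, l)) = i
    · obtain ⟨j, rfl⟩ := h
      rw [cellWeight, hinj.extend_apply]
      positivity
    · rw [cellWeight, Function.extend_apply' _ _ _ h]
      simp
  have hsupp : {i | cellWeight idx u i ≠ 0} = Set.range fun j => idx (j, fun l => u (j, l)) := by
    ext i
    by_cases h : ∃ j, idx (j, fun l => u (j, l)) = i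
    · obtain ⟨j, rfl⟩ := h
      simp only [Set.mem_ofPred_eq, Set.mem_range_self, iff_true, cellWeight]
      rw [hinj.extend_apply]
      exact inv_ne_zero hs0
    · simp only [Set.mem_ofPred_eq, cellWeight]
      rw [Function.extend_apply' _ _ _ h]
      simpa using h
  refine ⟨?_, ?_⟩
  · rw [hsupp, ← Set.image_univ, hinj.injOn.encard_image, Set.encard_univ]
    simp
  · have h := hasSum_cellWeight_mul hidx u fun _ => 1
    simp only [mul_one, Finset.sum_const, Finset.card_univ, Fintype.card_fin, nsmul_eq_mul,
      mul_inv_cancel₀ hs0] at h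
    simpa only [abs_of_nonneg (hnn _)] using h

lemma rewardFun_cellWeight_cellFeature (hs : 1 ≤ s) (hpt : Function.Injective pt)
    (hidx : Function.Injective idx) (Δ : ℝ) (u : Fin s × Fin d → Fin K) (c : Fin s × Fin d)
    (a : Fin K) :
    rewardFun (cellWeight idx u) (cellFeature pt idx (s * Δ)) (fun b => pt (c, b)) a =
      if a = u c then Δ else 0 := by
  have hs0 : (s : ℝ) ≠ 0 := by positivity
  rw [rewardFun, (hasSum_cellWeight_mul hidx u
    fun i => cellFeature pt idx (s * Δ) i (pt (c, a))).tsum_eq]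
  have hval (j : Fin s) : cellFeature pt idx (s * Δ) (idx (j, fun l => u (j, l))) (pt (c, a)) =
      if j = c.1 then (if a = u c then s * Δ else 0) else 0 := by
    classical
    rw [cellFeature, hidx.extend_apply, Set.indicator_apply]
    have hmem : (pt (c, a) ∈ Set.range fun l => pt ((j, l), u (j, l))) ↔ j = c.1 ∧ a = u c := by
      simp only [Set.mem_range, hpt.eq_iff, Prod.ext_iff]
      constructor
      · rintro ⟨l, ⟨rfl, rfl⟩, h⟩
        exact ⟨rfl, h.symm⟩
      · rintro ⟨rfl, rfl⟩
        exact ⟨c.2, ⟨rfl, rfl⟩, rfl⟩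
    simp only [hmem, ite_and]
  simp only [hval, mul_ite, mul_zero, Finset.sum_ite_eq', Finset.mem_univ, if_true]
  rw [inv_mul_cancel_left₀ hs0]

end

universe v w

lemma exists_injective_of_card_le {α : Type v} {Z : Type w} [Fintype α]
    (h : (Fintype.card α : ℕ∞) ≤ ENat.card Z) : ∃ f : α → Z, Function.Injective f := by
  rw [ENat.card, Cardinal.natCast_le_toENat] at h
  have h' : Cardinal.lift.{w} (Cardinal.mk α) ≤ Cardinal.lift.{v} (Cardinal.mk Z) := by
    rw [Cardinal.mk_fintype, Cardinal.lift_natCast]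
    simpa using h
  obtain ⟨f⟩ := Cardinal.lift_mk_le'.1 h'
  exact ⟨f, f.injective⟩

/-- In blocks of `m` rounds whose contexts are visited cyclically with period `d`, a round is
preceded by at most `m / d` rounds with the same context. -/
lemma card_filter_same_cell_mul_le {m d : ℕ} (hm : 1 ≤ m) (hd : 1 ≤ d) (t : ℕ) :
    ((Finset.range t).filter fun i => i / m = t / m ∧ i % d = t % d).card * d ≤ m := by
  have hcard : ((Finset.range t).filter fun i => i / m = t / m ∧ i % d = t % d).card ≤
      (Finset.Icc 1 (m / d)).card := by
    refine Finset.card_le_card_of_injOn (fun i => (t - i) / d) ?_ ?_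
    · intro i hi
      simp only [Finset.coe_filter, Finset.mem_range, Set.mem_ofPred_eq] at hi
      obtain ⟨hit, hdiv, hmod⟩ := hi
      have h1 := Nat.div_add_mod t m
      have h2 := Nat.div_add_mod i m
      have h3 := Nat.mod_lt t hm
      rw [hdiv] at h2
      have hdvd : d ∣ t - i := (Nat.modEq_iff_dvd' hit.le).1 hmod
      simp only [Finset.coe_Icc, Set.mem_Icc]
      exact ⟨Nat.div_pos (Nat.le_of_dvd (by omega) hdvd) hd, Nat.div_le_div_right (by omega)⟩
    · intro i hi i' hi' h
      simp only [Finset.coe_filter, Finset.mem_range, Set.mem_ofPred_eq] at hi hi'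
      have e1 := Nat.div_mul_cancel ((Nat.modEq_iff_dvd' hi.1.le).1 hi.2.2)
      have e2 := Nat.div_mul_cancel ((Nat.modEq_iff_dvd' hi'.1.le).1 hi'.2.2)
      simp only at h
      rw [h] at e1
      have := hi.1
      have := hi'.1
      omega
  rw [Nat.card_Icc, Nat.add_sub_cancel] at hcard
  exact (Nat.mul_le_mul_right d hcard).trans (Nat.div_mul_le_self m d)

/-- The lower bound for `s` blocks of `m` rounds in which `d` contexts alternate, for features
whose first `s * K ^ d` bounds `b i` are at least `s` times the gap `√(d * K / m) / 2`. -/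
lemma exists_sparse_le_regret {Z : Type*} [MeasurableSpace Z] [MeasurableSingletonClass Z]
    {s K d m : ℕ} (hs : 1 ≤ s) (hK : 2 ≤ K) (hd : 1 ≤ d) (hm : 1 ≤ m)
    (hZ : ((s * d * K : ℕ) : ℕ∞) ≤ ENat.card Z) {b : ℕ → ℝ} (hb : ∀ i, 0 ≤ b i)
    (hgap : ∀ i < s * K ^ d, s * (Real.sqrt (d * K / m) / 2) ≤ b i)
    (π : Policy (Fin K → Z) K) :
    ∃ (x : ℕ → Fin K → Z) (w : ℕ → ℝ) (φ : ℕ → Z → ℝ),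
      IsSparseUnit s w ∧ (∀ i, Measurable (φ i)) ∧ (∀ i z, |φ i z| ≤ b i) ∧
        1 / 8 * Real.sqrt (d * K * s * (s * m : ℕ)) ≤ regret π (rewardFun w φ) x (s * m) := by
  obtain ⟨pt, hpt⟩ : ∃ pt : (Fin s × Fin d) × Fin K → Z, Function.Injective pt :=
    exists_injective_of_card_le (by simpa using hZ)
  let e : Fin s × (Fin d → Fin K) ≃ Fin (s * K ^ d) :=
    Fintype.equivFinOfCardEq (by simp)
  let idx : Fin s × (Fin d → Fin K) → ℕ := fun q => e q
  have hidx : Function.Injective idx := Fin.val_injective.comp e.injective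
  set Δ : ℝ := Real.sqrt (d * K / m) / 2
  have hΔ : 0 ≤ Δ := by positivity
  let ctx : Fin s × Fin d → Fin K → Z := fun c a => pt (c, a)
  have hctx : Function.Injective ctx := fun c c' h =>
    congrArg Prod.fst (hpt (congrFun h ⟨0, by omega⟩))
  -- The remainder modulo `s` only serves to define the cell for the rounds after the last block.
  let cell : ℕ → Fin s × Fin d := fun t =>
    (⟨t / m % s, Nat.mod_lt _ hs⟩, ⟨t % d, Nat.mod_lt _ hd⟩)
  have hm0 : (0 : ℝ) < m := by positivity
  have hvisits (t : ℕ) (ht : t < s * m) :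
      ((Finset.range t).filter fun i => cell i = cell t).card * Δ ^ 2 ≤ K / 4 := by
    have hcell : ((Finset.range t).filter fun i => cell i = cell t) =
        (Finset.range t).filter fun i => i / m = t / m ∧ i % d = t % d := by
      refine Finset.filter_congr fun i hi => ?_
      have hts : t / m < s := Nat.div_lt_of_lt_mul (by rwa [mul_comm])
      have his : i / m < s :=
        (Nat.div_le_div_right (Finset.mem_range.1 hi).le).trans_lt hts
      simp [cell, Nat.mod_eq_of_lt hts, Nat.mod_eq_of_lt his]
    have hcount : ((((Finset.range t).filter fun i => cell i = cell t).card : ℕ) : ℝ) * d ≤ m := by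
      rw [hcell]
      exact_mod_cast card_filter_same_cell_mul_le hm hd t
    have hΔ2 : Δ ^ 2 = d * K / m / 4 := by
      rw [div_pow, Real.sq_sqrt (by positivity)]
      norm_num
    rw [hΔ2]
    calc ((((Finset.range t).filter fun i => cell i = cell t).card : ℕ) : ℝ) * (d * K / m / 4)
        = ((((Finset.range t).filter fun i => cell i = cell t).card : ℕ) : ℝ) * d * (K / m / 4) := by
          ring
      _ ≤ m * (K / m / 4) := mul_le_mul_of_nonneg_right hcount (by positivity)
      _ = K / 4 := by field_simp
  obtain ⟨u, hu⟩ := exists_le_regret π hK hctx hΔ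
    (F := fun u => rewardFun (cellWeight idx u) (cellFeature pt idx (s * Δ)))
    (fun u c a => rewardFun_cellWeight_cellFeature hs hpt hidx Δ u c a) cell (s * m) hvisits
  refine ⟨_, _, _, isSparseUnit_cellWeight hs hidx u, measurable_cellFeature hidx,
    abs_cellFeature_le hidx (by positivity) hb fun q => hgap _ (e q).2, le_trans (le_of_eq ?_) hu⟩
  have hsq : (d * K * s * (s * m : ℕ) : ℝ) = (s * m) ^ 2 * (d * K / m) := by
    push_cast
    field_simp
  rw [hsq, Real.sqrt_mul (by positivity), Real.sqrt_sq (by positivity)]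
  simp only [Δ]
  push_cast
  ring

end SparseBandit

end

theorem theorem1 {Z : Type*} [MeasurableSpace Z] [MeasurableSingletonClass Z]
    (s K : ℕ) (hs : 1 ≤ s) (hK : 2 ≤ K) :
    (∀ (β : ℝ) (m n : ℕ), 1 < β →
      ((s * K : ℕ) : ℕ∞) ≤ ENat.card Z →
      (s : ℝ) ^ (β + 2) * (K : ℝ) ^ (β + 1) ≤ m →
      n = s * m →
      ∀ π : SparseBandit.Policy (Fin K → Z) K,
        ∃ (x : ℕ → Fin K → Z) (w : ℕ → ℝ) (φ : ℕ → Z → ℝ),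
          SparseBandit.IsSparseUnit s w ∧
          (∀ i, Measurable (φ i)) ∧ SparseBandit.PolyDecay β φ ∧
          1 / 8 * Real.sqrt (K * s * n) ≤
            SparseBandit.regret π (SparseBandit.rewardFun w φ) x n) ∧
    (∀ (β : ℝ) (m n : ℕ), 0 < β →
      ((s * ⌈1 / β⌉₊ * K : ℕ) : ℕ∞) ≤ ENat.card Z →
      (⌈1 / β⌉₊ : ℝ) * (s : ℝ) ^ 2 * K *
        Real.exp ((s : ℝ) ^ β * (K : ℝ) ^ (β * (⌈1 / β⌉₊ : ℝ))) ≤ m →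
      n = s * m →
      ∀ π : SparseBandit.Policy (Fin K → Z) K,
        ∃ (x : ℕ → Fin K → Z) (w : ℕ → ℝ) (φ : ℕ → Z → ℝ),
          SparseBandit.IsSparseUnit s w ∧
          (∀ i, Measurable (φ i)) ∧ SparseBandit.ExpDecay β φ ∧
          1 / 8 * Real.sqrt (max 1 (1 / β) * K * s * n) ≤
            SparseBandit.regret π (SparseBandit.rewardFun w φ) x n) := by
  have hs0 : (0 : ℝ) < s := by positivity
  have hK0 : (0 : ℝ) < K := by exact_mod_cast (by omega : 0 < K)
  -- The gap is admissible as soon as the square of the bound on the features is large enough.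
  have hgap {d m : ℕ} (hm : 1 ≤ m) {b : ℝ} (hb : 0 ≤ b)
      (h : (s : ℝ) ^ 2 * (d * K) ≤ b ^ 2 * m) : s * (Real.sqrt (d * K / m) / 2) ≤ b := by
    have hm0 : (0 : ℝ) < m := by positivity
    have h2 : (s * Real.sqrt (d * K / m)) ^ 2 ≤ b ^ 2 := by
      rw [mul_pow, Real.sq_sqrt (by positivity), ← mul_div_assoc]
      exact (div_le_iff₀ hm0).2 h
    have h3 := le_of_sq_le_sq h2 hb
    have h4 : 0 ≤ s * Real.sqrt (d * K / m) := by positivity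
    linarith
  constructor
  · intro β m n hβ hZ hmβ hn π
    subst hn
    have hm : 1 ≤ m := by
      have : (0 : ℝ) < m := lt_of_lt_of_le (by positivity) hmβ
      exact_mod_cast this
    have hsK : (0 : ℝ) < s * K := by positivity
    obtain ⟨x, w, φ, hw, hφ, hφb, hreg⟩ :=
      SparseBandit.exists_sparse_le_regret (d := 1) hs hK le_rfl hm (by simpa using hZ)
        (b := fun i => ((i : ℝ) + 1) ^ (-β / 2)) (fun i => by positivity)
        (fun i hi => by
          refine (hgap (b := ((s : ℝ) * K) ^ (-β / 2)) hm (by positivity) ?_).trans ?_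
          · rw [← Real.rpow_mul_natCast hsK.le]
            have e : -β / 2 * ((2 : ℕ) : ℝ) = -β := by
              push_cast
              ring
            rw [e, Real.rpow_neg hsK.le, ← div_eq_inv_mul, le_div_iff₀ (by positivity)]
            refine le_trans (le_of_eq ?_) hmβ
            rw [Real.mul_rpow hs0.le hK0.le, Real.rpow_add hs0, Real.rpow_add hK0,
              Real.rpow_two, Real.rpow_one]
            push_cast
            ring
          · refine Real.rpow_le_rpow_of_nonpos (by positivity) ?_ (by linarith)
            rw [pow_one] at hi
            exact_mod_cast hi)
        π
    exact ⟨x, w, φ, hw, hφ, hφb, by simpa using hreg⟩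
  · intro β m n hβ hZ hmβ hn π
    subst hn
    set d := ⌈1 / β⌉₊
    have hd : 1 ≤ d := Nat.ceil_pos.2 (by positivity)
    have hd0 : (0 : ℝ) < d := by exact_mod_cast hd
    have hm : 1 ≤ m := by
      have : (0 : ℝ) < m := lt_of_lt_of_le (by positivity) hmβ
      exact_mod_cast this
    obtain ⟨x, w, φ, hw, hφ, hφb, hreg⟩ :=
      SparseBandit.exists_sparse_le_regret hs hK hd hm hZ
        (b := fun i => Real.exp (-((i : ℝ) + 1) ^ β / 2)) (fun i => by positivity)
        (fun i hi => by
          refine hgap hm (by positivity) ?_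
          have hi' : (i : ℝ) + 1 ≤ s * (K : ℝ) ^ d := by exact_mod_cast hi
          have hpow : ((i : ℝ) + 1) ^ β ≤ (s : ℝ) ^ β * (K : ℝ) ^ (β * (d : ℝ)) := by
            refine (Real.rpow_le_rpow (by positivity) hi' hβ.le).trans_eq ?_
            rw [Real.mul_rpow hs0.le (by positivity), mul_comm β, Real.rpow_natCast_mul hK0.le]
          rw [← Real.exp_nat_mul]
          have e : ((2 : ℕ) : ℝ) * (-((i : ℝ) + 1) ^ β / 2) = -((i : ℝ) + 1) ^ β := by
            push_cast
            ring
          rw [e, Real.exp_neg, ← div_eq_inv_mul, le_div_iff₀ (Real.exp_pos _)]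
          refine le_trans ?_ hmβ
          rw [show (s : ℝ) ^ 2 * (d * K) = d * (s : ℝ) ^ 2 * K by ring]
          gcongr)
        π
    refine ⟨x, w, φ, hw, hφ, hφb, le_trans ?_ hreg⟩
    have hmax : max 1 (1 / β) ≤ (d : ℝ) := max_le (by exact_mod_cast hd) (Nat.le_ceil _)
    gcongr
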